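/- Let $v$, $k$ and $\lambda$ be positive integers. A $(v,k,\lambda)$-covering is a pair $(V,\mathcal{B})$ where $V$ is a set of $v$ points and $\mathcal{B}$ is a finite collection of $k$-subsets of $V$ (blocks, repetitions allowed) such that every pair of distinct points lies in at least $\lambda$ blocks. It is symmetric if it has exactly $v$ blocks. Its excess is the loopless multigraph on $V$ in which distinct points $x,y$ are joined by exactly $r_{xy}-\lambda$ edges, where $r_{xy}$ is the number of blocks containing both $x$ and $y$. Suppose that $k>\lambda+2$, that $v=\frac{k(k-1)-2}{\lambda}+1$, and that $v$ is odd. Then there does not exist a symmetric $(v,k,\lambda)$-covering whose excess is a Hamilton cycle (a single cycle through all $v$ points) if there is a prime $p\equiv 3\pmod 4$ that divides both $v$ and $k-\lambda+2$ and is such that, writing $\alpha$ and $\delta$ for the exponents of $p$ in the prime factorisations of $k-\lambda+2$ and $v$ respectively and, when $\lambda>2$, $\gamma$ for the exponent of $p$ in that of $\lambda-2$, either (i) $\alpha$ is odd, $(p,\alpha)\neq(3,1)$, and either $\lambda=2$, or $\lambda>2$ and $\alpha<2\gamma$; or (ii) $\lambda>2$, $\alpha=2\gamma$ and $\delta$ is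 odd. -/

import Mathlib

/-- A loopless finite multigraph on the vertex set `V`, given by its edge multiplicities. -/
@[ext]
structure LooplessMultigraph (V : Type*) where
  /-- the number of edges joining `x` and `y` -/
  mult : V → V → ℕ
  mult_symm : ∀ x y, mult x y = mult y x
  mult_self : ∀ x, mult x x = 0

/-- `G` is a Hamilton cycle: the vertices can be listed cyclically as `e 0, e 1, …, e (n - 1)`,
`n ≥ 2`, so that the edges of `G` are exactly the `n` edges joining consecutive vertices
(counted with multiplicity: for `n = 2` this is a pair of parallel edges). -/
def LooplessMultigraph.IsHamiltonCycle {V : Type*} [Fintype V] [DecidableEq V]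
    (G : LooplessMultigraph V) : Prop :=
  2 ≤ Fintype.card V ∧
    ∃ e : Fin (Fintype.card V) ≃ V, ∀ x y : V,
      G.mult x y =
        (Finset.univ.filter fun i : Fin (Fintype.card V) =>
          s(e i, e (finRotate (Fintype.card V) i)) = s(x, y)).card

/-- A `(v, k, lam)`-covering with point set `V`: `V` has `v` elements, the blocks form a finite
collection (repetitions allowed) of `k`-subsets of `V`, and every pair of distinct points is
contained in at least `lam` blocks. -/
structure PairCovering (V : Type*) [Fintype V] [DecidableEq V] (v k lam : ℕ) where
  blocks : Multiset (Finset V)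
  card_points : Fintype.card V = v
  card_block : ∀ B ∈ blocks, B.card = k
  covers : ∀ x y : V, x ≠ y → lam ≤ (blocks.filter fun B => x ∈ B ∧ y ∈ B).card

namespace PairCovering

variable {V : Type*} [Fintype V] [DecidableEq V] {v k lam : ℕ}

/-- The number `r x y` of blocks that contain both `x` and `y`. -/
def r (C : PairCovering V v k lam) (x y : V) : ℕ :=
  (C.blocks.filter fun B => x ∈ B ∧ y ∈ B).card

/-- A covering is symmetric if it has as many blocks as points. -/
def IsSymmetric (C : PairCovering V v k lam) : Prop :=
  Multiset.card C.blocks = v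

/-- The excess: distinct points `x`, `y` are joined by `r x y - lam` edges. The subtraction does
not truncate, since `lam ≤ r x y` for distinct points. -/
def excess (C : PairCovering V v k lam) : LooplessMultigraph V where
  mult x y := if x = y then 0 else C.r x y - lam
  mult_symm x y := by simp only [r, eq_comm (a := x) (b := y), and_comm]
  mult_self x := by simp

end PairCovering

/-! Symmetric coverings whose excess is a Hamilton cycle: nonexistence via the incidence matrix
modulo a prime `p ≡ 3 [MOD 4]`. -/

/-! Put u = k - λ + 2, so k² = u + λv. The incidence matrix A satisfies A Aᵀ = (u - 2)I + λJ + C,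
where C is the adjacency matrix of the cycle. Modulo p this Gram operator is a second difference
plus λJ, and it is injective on vectors vanishing at two adjacent vertices (`dvd_of_dvd_gram`). Take
an integer Z with Aᵀ Z = N e_b, where N = det A ≠ 0. Its values at the two ends of [-h, h] are
cancelled by an odd and an even vector whose Gram images are supported on those ends (`gram_oddFun`,
`gram_evenFun`). The result X has Gram image divisible by N, so X is divisible by the full power of
p in N. Pairing X with column b then yields s² = -1 modulo p, impossible for p ≡ 3 mod 4. The prime
3 needs 9 ∣ v, because the power sums involved are multiples of v divided by 3. -/

namespace HamiltonExcess

open Matrix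

/-! ### Recurrence solutions on ℤ and their residues modulo p. -/

/-- The odd solution of `s (n + 1) = (2 - u) s n - s (n - 1)`, on the natural numbers. -/
def oddSeq (u : ℤ) : ℕ → ℤ
  | 0 => 0
  | 1 => 1
  | n + 2 => (2 - u) * oddSeq u (n + 1) - oddSeq u n

/-- The even solution of `e (n + 1) = 2 + (2 - u) e n - e (n - 1)`, on the natural numbers. -/
def evenSeq (u : ℤ) : ℕ → ℤ
  | 0 => 0
  | 1 => 1
  | n + 2 => 2 + (2 - u) * evenSeq u (n + 1) - evenSeq u n

/-- `oddSeq` as an odd function on `ℤ`. -/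
def oddFun (u n : ℤ) : ℤ := n.sign * oddSeq u n.natAbs

/-- `evenSeq` as an even function on `ℤ`. -/
def evenFun (u n : ℤ) : ℤ := evenSeq u n.natAbs

theorem oddFun_neg (u n : ℤ) : oddFun u (-n) = -oddFun u n := by
  simp [oddFun]

theorem evenFun_neg (u n : ℤ) : evenFun u (-n) = evenFun u n := by
  simp [evenFun]

theorem oddFun_natCast (u : ℤ) (n : ℕ) : oddFun u n = oddSeq u n := by
  cases n with
  | zero => simp [oddFun, oddSeq]
  | succ n =>
    rw [oddFun, Int.natAbs_natCast, Int.sign_eq_one_of_pos (by positivity), one_mul]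

theorem evenFun_natCast (u : ℤ) (n : ℕ) : evenFun u n = evenSeq u n := by
  simp [evenFun]

theorem oddFun_rec_natCast (u : ℤ) (n : ℕ) :
    oddFun u (n + 1) + oddFun u (n - 1) = (2 - u) * oddFun u n := by
  cases n with
  | zero =>
    have := oddFun_neg u 1
    have h0 := oddFun_natCast u 0
    simp only [oddSeq, Nat.cast_zero] at *
    simp [this, h0]
  | succ n =>
    have h0 := oddFun_natCast u n
    have h1 := oddFun_natCast u (n + 1)
    have h2 := oddFun_natCast u (n + 2)
    push_cast at *
    rw [show (n : ℤ) + 1 + 1 = n + 2 by ring, add_sub_cancel_right, h0, h1, h2, oddSeq]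
    ring

theorem oddFun_rec (u n : ℤ) :
    oddFun u (n + 1) + oddFun u (n - 1) = (2 - u) * oddFun u n := by
  obtain ⟨m, rfl | rfl⟩ := Int.eq_nat_or_neg n
  · exact oddFun_rec_natCast u m
  · have h := oddFun_rec_natCast u m
    rw [show -(m : ℤ) + 1 = -(m - 1) by ring, show -(m : ℤ) - 1 = -(m + 1) by ring]
    simp only [oddFun_neg]
    linarith

theorem evenFun_rec_natCast (u : ℤ) (n : ℕ) :
    evenFun u (n + 1) + evenFun u (n - 1) = 2 + (2 - u) * evenFun u n := by
  cases n with
  | zero =>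
    simp [evenFun, evenSeq]
  | succ n =>
    have h0 := evenFun_natCast u n
    have h1 := evenFun_natCast u (n + 1)
    have h2 := evenFun_natCast u (n + 2)
    push_cast at *
    rw [show (n : ℤ) + 1 + 1 = n + 2 by ring, add_sub_cancel_right, h0, h1, h2, evenSeq]
    ring

theorem evenFun_rec (u n : ℤ) :
    evenFun u (n + 1) + evenFun u (n - 1) = 2 + (2 - u) * evenFun u n := by
  obtain ⟨m, rfl | rfl⟩ := Int.eq_nat_or_neg n
  · exact evenFun_rec_natCast u m
  · have h := evenFun_rec_natCast u m
    rw [show -(m : ℤ) + 1 = -(m - 1) by ring, show -(m : ℤ) - 1 = -(m + 1) by ring]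
    simp only [evenFun_neg]
    linarith

/-- The constant 2 cancels in differences, so both sides obey one homogeneous recurrence. Hence the
odd and even vectors share the same defect τ at the seam of the cycle. -/
theorem evenSeq_succ_sub (u : ℤ) (n : ℕ) :
    evenSeq u (n + 1) - evenSeq u n = oddSeq u n + oddSeq u (n + 1) := by
  induction n using Nat.twoStepInduction with
  | zero => simp [evenSeq, oddSeq]
  | one => simp [evenSeq, oddSeq]; ring
  | more n h0 h1 =>
    simp only [evenSeq, oddSeq] at *
    linear_combination (2 - u) * h1 - h0

variable {p : ℕ} {u : ℤ}

theorem oddSeq_cast_zmod (hu : (u : ZMod p) = 0) (n : ℕ) : (oddSeq u n : ZMod p) = n := by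
  induction n using Nat.twoStepInduction with
  | zero => simp [oddSeq]
  | one => simp [oddSeq]
  | more n h0 h1 =>
    simp only [oddSeq]
    push_cast at *
    rw [h0, h1, hu]
    ring

theorem evenSeq_cast_zmod (hu : (u : ZMod p) = 0) (n : ℕ) :
    (evenSeq u n : ZMod p) = (n : ZMod p) ^ 2 := by
  induction n using Nat.twoStepInduction with
  | zero => simp [evenSeq]
  | one => simp [evenSeq]
  | more n h0 h1 =>
    simp only [evenSeq]
    push_cast at *
    rw [h0, h1, hu]
    ring

theorem evenFun_cast_zmod (hu : (u : ZMod p) = 0) (n : ℤ) :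
    (evenFun u n : ZMod p) = (n : ZMod p) ^ 2 := by
  rw [evenFun, evenSeq_cast_zmod hu]
  have : ((n.natAbs : ℤ)) ^ 2 = n ^ 2 := by simp
  exact_mod_cast congrArg (Int.cast : ℤ → ZMod p) this

/-! ### Second differences on an odd cycle. -/

/-- The second difference along the cycle `Fin (2 * h + 1)`. -/
def cycDiff {h : ℕ} (x : Fin (2 * h + 1) → ℤ) (i : Fin (2 * h + 1)) : ℤ :=
  x (i + 1) + x (i - 1) - 2 * x i

theorem sum_cycDiff {h : ℕ} (x : Fin (2 * h + 1) → ℤ) : ∑ i, cycDiff x i = 0 := by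
  simp only [cycDiff, Finset.sum_sub_distrib, Finset.sum_add_distrib, ← Finset.mul_sum]
  have h1 := Equiv.sum_comp (Equiv.addRight (1 : Fin (2 * h + 1))) x
  have h2 := Equiv.sum_comp (Equiv.subRight (1 : Fin (2 * h + 1))) x
  simp only [Equiv.coe_addRight, Equiv.subRight_apply] at h1 h2
  rw [h1, h2]
  ring

/-- The restriction of a function on `ℤ` to `[-h, h]`, indexed by `Fin (2 * h + 1)`. -/
def centred (h : ℕ) (f : ℤ → ℤ) (i : Fin (2 * h + 1)) : ℤ := f ((i : ℤ) - h)

/-- The corrections come from the seam, where the cycle jumps from h to -h instead of h + 1. -/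
theorem cycDiff_centred {h : ℕ} (f : ℤ → ℤ) (i : Fin (2 * h + 1)) :
    cycDiff (centred h f) i =
      f ((i : ℤ) - h + 1) + f ((i : ℤ) - h - 1) - 2 * f ((i : ℤ) - h) +
      (if i = Fin.last _ then f (-h) - f (h + 1) else 0) +
      (if i = 0 then f h - f (-h - 1) else 0) := by
  have h1 : centred h f (i + 1) = f ((i : ℤ) - h + 1) +
      (if i = Fin.last _ then f (-h) - f (h + 1) else 0) := by
    split_ifs with hi
    · subst hi
      simp only [centred, Fin.last_add_one, Fin.val_zero, Fin.val_last]
      push_cast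
      rw [show (2 : ℤ) * h - h + 1 = h + 1 by ring, show (0 : ℤ) - h = -h by ring]
      ring
    · have : ((i + 1 : Fin (2 * h + 1)) : ℕ) = i + 1 := by
        rw [Fin.val_add_one, if_neg hi]
      simp only [centred, this]
      push_cast
      rw [show (i : ℤ) + 1 - h = i - h + 1 by ring]
      ring
  have h2 : centred h f (i - 1) = f ((i : ℤ) - h - 1) +
      (if i = 0 then f h - f (-h - 1) else 0) := by
    split_ifs with hi
    · subst hi
      have : (0 - 1 : Fin (2 * h + 1)) = Fin.last _ := by
        rw [sub_eq_iff_eq_add, Fin.last_add_one]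
      simp only [centred, this, Fin.val_last, Fin.val_zero]
      push_cast
      rw [show (2 : ℤ) * h - h = h by ring, show (0 : ℤ) - h - 1 = -h - 1 by ring]
      ring
    · have : ((i - 1 : Fin (2 * h + 1)) : ℕ) = i - 1 := Fin.val_sub_one_of_ne_zero hi
      have h0 : 1 ≤ (i : ℕ) := Nat.one_le_iff_ne_zero.2 fun h => hi (Fin.ext h)
      simp only [centred, this]
      push_cast [h0]
      rw [show (i : ℤ) - 1 - h = i - h - 1 by ring]
      ring
  rw [cycDiff, h1, h2, centred]
  ring

theorem cycDiff_oddFun (u : ℤ) {h : ℕ} (i : Fin (2 * h + 1)) :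
    cycDiff (centred h (oddFun u)) i = -u * centred h (oddFun u) i -
      (oddSeq u h + oddSeq u (h + 1)) *
        ((if i = Fin.last _ then 1 else 0) - (if i = 0 then 1 else 0)) := by
  have h1 := oddFun_natCast u (h + 1)
  push_cast at h1
  rw [cycDiff_centred, oddFun_rec, show -(h : ℤ) - 1 = -(h + 1) by ring]
  simp only [oddFun_neg, oddFun_natCast, h1, centred]
  split_ifs <;> ring

theorem cycDiff_evenFun (u : ℤ) {h : ℕ} (i : Fin (2 * h + 1)) :
    cycDiff (centred h (evenFun u)) i = 2 - u * centred h (evenFun u) i -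
      (oddSeq u h + oddSeq u (h + 1)) *
        ((if i = Fin.last _ then 1 else 0) + (if i = 0 then 1 else 0)) := by
  have h1 := evenFun_natCast u (h + 1)
  push_cast at h1
  rw [cycDiff_centred, evenFun_rec, show -(h : ℤ) - 1 = -(h + 1) by ring, ← evenSeq_succ_sub]
  simp only [evenFun_neg, evenFun_natCast, h1, centred]
  split_ifs <;> ring

theorem sum_centred_oddFun (hu : u ≠ 0) (h : ℕ) : ∑ i, centred h (oddFun u) i = 0 := by
  have := sum_cycDiff (centred h (oddFun u))
  simp only [cycDiff_oddFun, Finset.sum_sub_distrib, ← Finset.mul_sum, Finset.sum_ite_eq',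
    Finset.mem_univ, if_true] at this
  simpa [hu] using this

/-- A cyclic second difference sums to zero. For p odd dividing u and v, this forces p ∣ τ. -/
theorem mul_sum_centred_evenFun (u : ℤ) (h : ℕ) :
    u * ∑ i, centred h (evenFun u) i =
      2 * (2 * h + 1) - 2 * (oddSeq u h + oddSeq u (h + 1)) := by
  have := sum_cycDiff (centred h (evenFun u))
  simp only [cycDiff_evenFun, Finset.sum_sub_distrib, Finset.sum_add_distrib, ← Finset.mul_sum,
    Finset.sum_ite_eq', Finset.mem_univ, if_true, Finset.sum_const, Finset.card_univ,
    Fintype.card_fin, nsmul_eq_mul] at this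
  push_cast at this
  linarith

theorem three_mul_sum_sq (h : ℕ) :
    3 * ∑ i : Fin (2 * h + 1), ((i : ℤ) - h) ^ 2 = (2 * h + 1) * h * (h + 1) := by
  have key (n : ℕ) (c : ℤ) : 6 * ∑ i ∈ Finset.range n, ((i : ℤ) - c) ^ 2 =
      n * (n - 1) * (2 * n - 1) - 6 * c * n * (n - 1) + 6 * c ^ 2 * n := by
    induction n with
    | zero => simp
    | succ n ih => rw [Finset.sum_range_succ, mul_add, ih]; push_cast; ring
  have := key (2 * h + 1) h
  rw [← Fin.sum_univ_eq_sum_range (fun i => ((i : ℤ) - h) ^ 2)] at this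
  push_cast at this
  linarith

theorem three_mul_sum_mul_succ (n : ℕ) :
    3 * ∑ i : Fin n, ((i : ℤ) * (i + 1)) = (n - 1) * n * (n + 1) := by
  rw [Fin.sum_univ_eq_sum_range (fun i => ((i : ℤ) * (i + 1)))]
  induction n with
  | zero => simp
  | succ n ih => rw [Finset.sum_range_succ, mul_add, ih]; push_cast; ring

/-! ### The Gram operator and its kernel modulo p. -/

/-- The action of the matrix `(u - 2) I + lam J + C`, `C` the adjacency matrix of the cycle. -/
def gram (u lam : ℤ) {h : ℕ} (x : Fin (2 * h + 1) → ℤ) (i : Fin (2 * h + 1)) : ℤ :=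
  u * x i + cycDiff x i + lam * ∑ j, x j

theorem gram_oddFun (hu : u ≠ 0) (lam : ℤ) {h : ℕ} (i : Fin (2 * h + 1)) :
    gram u lam (centred h (oddFun u)) i = -(oddSeq u h + oddSeq u (h + 1)) *
        ((if i = Fin.last _ then 1 else 0) - (if i = 0 then 1 else 0)) := by
  rw [gram, sum_centred_oddFun hu, cycDiff_oddFun]
  ring

theorem gram_evenFun (u lam : ℤ) {h : ℕ} (i : Fin (2 * h + 1)) :
    gram u lam (centred h (evenFun u)) i =
      2 + lam * (∑ j, centred h (evenFun u) j) - (oddSeq u h + oddSeq u (h + 1)) *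
        ((if i = Fin.last _ then 1 else 0) + (if i = 0 then 1 else 0)) := by
  rw [gram, cycDiff_evenFun]
  ring

/-- A vector that vanishes at both ends of `[-h, h]` and is annihilated by the Gram matrix
modulo `p` vanishes modulo `p`. -/
theorem dvd_of_dvd_gram [Fact p.Prime] (hp2 : p ≠ 2) {lam : ℤ} {h : ℕ} (hu : (p : ℤ) ∣ u)
    (hs : (p : ℤ) ∣ ∑ i : Fin (2 * h + 1), ((i : ℤ) * (i + 1)))
    {x : Fin (2 * h + 1) → ℤ} (h0 : x 0 = 0) (h1 : x (Fin.last _) = 0)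
    (hx : ∀ i, (p : ℤ) ∣ gram u lam x i) (i : Fin (2 * h + 1)) : (p : ℤ) ∣ x i := by
  have two : (2 : ZMod p) ≠ 0 := by
    intro h2
    have h2' : ((2 : ℕ) : ZMod p) = 0 := by exact_mod_cast h2
    rw [ZMod.natCast_eq_zero_iff] at h2'
    exact hp2 ((Nat.prime_dvd_prime_iff_eq Fact.out Nat.prime_two).1 h2')
  simp only [← ZMod.intCast_zmod_eq_zero_iff_dvd] at *
  set μ : ZMod p := ((lam * ∑ j, x j : ℤ) : ZMod p) with hμ
  have step (i : Fin (2 * h + 1)) :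
      (x (i + 1) : ZMod p) = 2 * x i - x (i - 1) - μ := by
    have := hx i
    simp only [gram, cycDiff] at this
    push_cast [hu] at this
    rw [hμ]
    push_cast
    linear_combination this
  -- Modulo p the second difference is the constant -μ, so x is quadratic. Its roots are the
  -- adjacent positions 0 and -1, the latter being `Fin.last`.
  have main (n : ℕ) (hn : n < 2 * h + 1) :
      2 * (x ⟨n, hn⟩ : ZMod p) = -μ * (n * (n + 1)) := by
    induction n using Nat.twoStepInduction with
    | zero => simp [h0]
    | one =>
      have := step 0
      have e1 : (0 - 1 : Fin (2 * h + 1)) = Fin.last _ := by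
        rw [sub_eq_iff_eq_add, Fin.last_add_one]
      have e2 : (0 + 1 : Fin (2 * h + 1)) = ⟨1, hn⟩ := by
        ext
        rw [Fin.val_add_one, if_neg]
        · simp
        · intro h; simp [Fin.ext_iff] at h; omega
      rw [e1, e2, h0, h1] at this
      rw [this]
      push_cast
      ring
    | more n ih0 ih1 =>
      have := step ⟨n + 1, by omega⟩
      have e1 : (⟨n + 1, by omega⟩ - 1 : Fin (2 * h + 1)) = ⟨n, by omega⟩ := by
        ext
        rw [Fin.val_sub_one_of_ne_zero]
        · simp
        · intro h; simp [Fin.ext_iff] at h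
      have e2 : (⟨n + 1, by omega⟩ + 1 : Fin (2 * h + 1)) = ⟨n + 2, hn⟩ := by
        ext
        rw [Fin.val_add_one, if_neg]
        intro h; simp [Fin.ext_iff] at h; omega
      rw [e1, e2] at this
      rw [this]
      have i0 := ih0 (by omega)
      have i1 := ih1 (by omega)
      push_cast at *
      linear_combination 2 * i1 - i0
  -- Summing the quadratic formula and using `hs` kills ∑ x, of which μ is a multiple.
  have hμ0 : μ = 0 := by
    have : 2 * ((∑ j, x j : ℤ) : ZMod p) = 0 := by
      push_cast
      rw [Finset.mul_sum, Finset.sum_congr rfl fun (j : Fin (2 * h + 1)) _ => main j j.2, ← Finset.mul_sum]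
      push_cast at hs
      rw [hs, mul_zero]
    have := (mul_eq_zero.1 this).resolve_left two
    rw [hμ, Int.cast_mul, this, mul_zero]
  have := main i i.2
  rw [hμ0, neg_zero, zero_mul] at this
  exact (mul_eq_zero.1 this).resolve_left two

theorem gram_smul (u lam c : ℤ) {h : ℕ} (x : Fin (2 * h + 1) → ℤ) (i : Fin (2 * h + 1)) :
    gram u lam (fun j => c * x j) i = c * gram u lam x i := by
  simp only [gram, cycDiff, ← Finset.mul_sum]
  ring

theorem pow_dvd_of_pow_dvd_gram [Fact p.Prime] (hp2 : p ≠ 2) {lam : ℤ} {h : ℕ}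
    (hu : (p : ℤ) ∣ u) (hs : (p : ℤ) ∣ ∑ i : Fin (2 * h + 1), ((i : ℤ) * (i + 1))) (t : ℕ)
    {x : Fin (2 * h + 1) → ℤ} (h0 : x 0 = 0) (h1 : x (Fin.last _) = 0)
    (hx : ∀ i, (p : ℤ) ^ t ∣ gram u lam x i) (i : Fin (2 * h + 1)) : (p : ℤ) ^ t ∣ x i := by
  have hp0 : (p : ℤ) ≠ 0 := by exact_mod_cast (Fact.out : p.Prime).ne_zero
  induction t generalizing x i with
  | zero => simp
  | succ t ih =>
    have hd := dvd_of_dvd_gram hp2 hu hs h0 h1 fun i =>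
      (dvd_pow_self (p : ℤ) t.succ_ne_zero).trans (hx i)
    choose y hy using hd
    obtain rfl : x = fun j => (p : ℤ) * y j := funext hy
    have := ih (x := y) ((mul_eq_zero.1 h0).resolve_left hp0)
      ((mul_eq_zero.1 h1).resolve_left hp0)
      (fun i => by
        have := hx i
        rw [gram_smul, pow_succ'] at this
        exact (mul_dvd_mul_iff_left hp0).1 this) i
    rw [pow_succ']
    exact mul_dvd_mul_left _ this

theorem gram_comb (u lam a b c : ℤ) {h : ℕ} (x y z : Fin (2 * h + 1) → ℤ)
    (i : Fin (2 * h + 1)) :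
    gram u lam (fun j => a * x j + b * y j + c * z j) i =
      a * gram u lam x i + b * gram u lam y i + c * gram u lam z i := by
  simp only [gram, cycDiff, Finset.sum_add_distrib, ← Finset.mul_sum]
  ring

theorem gram_one (u lam : ℤ) {h : ℕ} (i : Fin (2 * h + 1)) :
    gram u lam (fun _ => 1) i = u + lam * (2 * h + 1) := by
  simp [gram, cycDiff]

/-! ### The contradiction modulo p. -/

/-- If `A Aᵀ` is the Gram matrix of a symmetric covering with Hamiltonian excess, then no column
sum of `A` can equal the block size. -/
theorem false_of_mul_transpose_eq_gram {p : ℕ} [Fact p.Prime] (hp4 : p % 4 = 3) {h : ℕ}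
    {k lam u : ℤ} (hk : k ≠ 0) (hu0 : u ≠ 0) (hk2 : k ^ 2 = u + lam * (2 * h + 1))
    (hu : (p : ℤ) ∣ u) (hv : (p : ℤ) ∣ 2 * h + 1)
    (hsq : (p : ℤ) ∣ ∑ i : Fin (2 * h + 1), ((i : ℤ) - h) ^ 2)
    (hs : (p : ℤ) ∣ ∑ i : Fin (2 * h + 1), ((i : ℤ) * (i + 1)))
    (A : Matrix (Fin (2 * h + 1)) (Fin (2 * h + 1)) ℤ) (hdet : A.det ≠ 0)
    (hA : ∀ x, A *ᵥ (Aᵀ *ᵥ x) = gram u lam x) (b : Fin (2 * h + 1))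
    (hb : ∑ i, A i b = k) : False := by
  have hp : p.Prime := Fact.out
  have hp' : Prime (p : ℤ) := Nat.prime_iff_prime_int.1 hp
  have hp2 : p ≠ 2 := by rintro rfl; omega
  have hpk : (p : ℤ) ∣ k := hp'.dvd_of_dvd_pow (hk2 ▸ dvd_add hu (hv.mul_left _))
  have symm (x y : Fin (2 * h + 1) → ℤ) :
      ∑ i, x i * gram u lam y i = ∑ i, gram u lam x i * y i := by
    change x ⬝ᵥ gram u lam y = gram u lam x ⬝ᵥ y
    rw [← hA, ← hA, dotProduct_mulVec, ← mulVec_transpose, dotProduct_comm (A *ᵥ _) y,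
      dotProduct_mulVec, ← mulVec_transpose, transpose_transpose, dotProduct_comm]
  obtain ⟨Z, hZ⟩ : ∃ Z, Aᵀ *ᵥ Z = A.det • Pi.single b 1 :=
    ⟨Aᵀ.adjugate *ᵥ Pi.single b 1, by
      rw [mulVec_mulVec, mul_adjugate, det_transpose, smul_mulVec, one_mulVec]⟩
  obtain ⟨t, N', hN', hN⟩ : ∃ (t : ℕ) (N' : ℤ), A.det = (p : ℤ) ^ t * N' ∧ ¬(p : ℤ) ∣ N' :=
    ⟨_, (Int.finiteMultiplicity_iff.2
      ⟨by simpa using hp.ne_one, hdet⟩).exists_eq_pow_mul_and_not_dvd⟩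
  generalize A.det = N at *
  have hgZ (i) : gram u lam Z i = N * A i b := by
    rw [← hA, hZ, mulVec_smul, mulVec_single_one]; rfl
  have hZb : ∑ i, Z i * A i b = N := by
    have := congrFun hZ b
    simp only [mulVec, dotProduct, transpose_apply, Pi.smul_apply, Pi.single_eq_same,
      smul_eq_mul, mul_one] at this
    rw [← this]
    exact Finset.sum_congr rfl fun i _ => mul_comm _ _
  set Sf := centred h (oddFun u) with hSf
  set Ef := centred h (evenFun u) with hEf
  set τ := oddSeq u h + oddSeq u (h + 1) with hτ
  set σ := ∑ j, Ef j with hσ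
  -- The Gram images of 1 and Ef have constant parts k² and 2 + λσ; this combination cancels them.
  -- The term 0 * 0 only fits the shape of `gram_comb`.
  set G : Fin (2 * h + 1) → ℤ := fun i => (2 + lam * σ) * 1 + -k ^ 2 * Ef i + 0 * 0 with hG
  have hgS (i) : gram u lam Sf i =
      -τ * ((if i = Fin.last _ then 1 else 0) - (if i = 0 then 1 else 0)) := gram_oddFun hu0 lam i
  have hgG (i) : gram u lam G i =
      k ^ 2 * τ * ((if i = Fin.last _ then 1 else 0) + (if i = 0 then 1 else 0)) := by
    rw [hG, gram_comb, gram_one, gram_evenFun, ← hk2]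
    ring
  set S := oddSeq u h with hS
  have hSl : Sf (Fin.last _) = S := by
    rw [hS, ← oddFun_natCast, hSf, centred, Fin.val_last]; congr 1; push_cast; ring
  have hS0 : Sf 0 = -S := by
    rw [hS, ← oddFun_natCast, ← oddFun_neg, hSf, centred, Fin.val_zero]; congr 1; simp
  have hEl : Ef (Fin.last _) = evenFun u h := by
    rw [hEf, centred, Fin.val_last]; congr 1; push_cast; ring
  have hE0 : Ef 0 = evenFun u h := by
    rw [← evenFun_neg, hEf, centred, Fin.val_zero]; congr 1; simp
  set g := G 0 with hg
  have hGl : G (Fin.last _) = g := by simp only [hg, hG, hEl, hE0]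
  set s := ∑ i, Sf i * A i b with hs'
  set r := 2 + lam * σ - k * ∑ i, Ef i * A i b with hr
  have hGr : ∑ i, G i * A i b = k * r := by
    have hGA (i) : G i * A i b = (2 + lam * σ) * A i b - k ^ 2 * (Ef i * A i b) := by
      simp only [hG]; ring
    simp only [hGA, Finset.sum_sub_distrib, ← Finset.mul_sum, hb, hr]
    ring
  set a := Z (Fin.last _) - Z 0 with ha
  set c := Z (Fin.last _) + Z 0 with hc
  -- Self-adjointness of the Gram operator, applied to Sf and Z, and below to G and Z.
  have hτa : -τ * a = N * s := by
    have := symm Sf Z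
    simp only [hgZ, hgS, mul_left_comm _ N, ← Finset.mul_sum, mul_assoc, sub_mul, ite_mul, one_mul,
      zero_mul, Finset.sum_sub_distrib, Finset.sum_ite_eq', Finset.mem_univ, if_true] at this
    exact this.symm
  have hτc : k * τ * c = N * r := by
    have := symm G Z
    simp only [hgZ, hgG, mul_left_comm _ N, ← Finset.mul_sum, mul_assoc, add_mul, ite_mul, one_mul,
      zero_mul, Finset.sum_add_distrib, Finset.sum_ite_eq', Finset.mem_univ, if_true] at this
    rw [hGr] at this
    apply mul_left_cancel₀ hk
    linear_combination -this
  -- The ends of Sf are -S and S, and those of G are both g; these coefficients make X vanish at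
  -- both ends without division.
  set X : Fin (2 * h + 1) → ℤ := fun i => 2 * S * g * Z i + -(a * g) * Sf i + -(c * S) * G i
    with hX
  have hX0 : X 0 = 0 := by
    simp only [hX, hS0, ← hg, ha, hc]; ring
  have hXl : X (Fin.last _) = 0 := by
    simp only [hX, hSl, hGl, ha, hc]; ring
  have hgX (i) : N ∣ gram u lam X i := by
    refine ⟨2 * S * g * A i b - s * g * ((if i = Fin.last _ then 1 else 0) - (if i = 0 then 1 else 0))
      - k * r * S * ((if i = Fin.last _ then 1 else 0) + (if i = 0 then 1 else 0)), ?_⟩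
    rw [hX, gram_comb, hgZ, hgS, hgG]
    linear_combination
      (-g * ((if i = Fin.last _ then 1 else 0) - (if i = 0 then 1 else 0))) * hτa
      - k * S * ((if i = Fin.last _ then 1 else 0) + (if i = 0 then 1 else 0)) * hτc
  have hXd := pow_dvd_of_pow_dvd_gram hp2 (lam := lam) hu hs t hX0 hXl
    fun i => (Dvd.intro _ hN'.symm).trans (hgX i)
  have hXA : ∑ i, X i * A i b = 2 * S * g * N - a * g * s - c * S * (k * r) := by
    have hXi (i) : X i * A i b = 2 * S * g * (Z i * A i b) - a * g * (Sf i * A i b)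
        - c * S * (G i * A i b) := by
      simp only [hX]; ring
    simp only [hXi, Finset.sum_sub_distrib, ← Finset.mul_sum, hZb, hGr, ← hs']
  have hpτ : (p : ℤ) ∣ τ := by
    have h1 := mul_sum_centred_evenFun u h
    have h2 : (p : ℤ) ∣ 2 * τ := by
      rw [show 2 * τ = 2 * (2 * h + 1) - u * σ by linarith]
      exact dvd_sub (hv.mul_left _) (hu.mul_right _)
    refine (hp'.dvd_or_dvd h2).resolve_left fun h3 => hp2 ?_
    exact (Nat.prime_dvd_prime_iff_eq hp Nat.prime_two).1 (by exact_mod_cast h3)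
  -- Multiplying by τ trades a and c for N s and N r. Cancelling p ^ t against N leaves the factor p
  -- supplied by τ.
  have hfin : (p : ℤ) ∣ 2 * S * g * τ + g * s ^ 2 - S * r ^ 2 := by
    have h1 : τ * ∑ i, X i * A i b = N * (2 * S * g * τ + g * s ^ 2 - S * r ^ 2) := by
      rw [hXA]
      linear_combination g * s * hτa - S * r * hτc
    obtain ⟨w, hw⟩ : (p : ℤ) ^ t ∣ ∑ i, X i * A i b :=
      Finset.dvd_sum fun i _ => (hXd i).mul_right _
    have hpt : (p : ℤ) ^ t ≠ 0 := pow_ne_zero _ hp'.ne_zero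
    have h2 : τ * w = N' * (2 * S * g * τ + g * s ^ 2 - S * r ^ 2) := by
      apply mul_left_cancel₀ hpt
      rw [hw, hN'] at h1
      linear_combination h1
    exact (hp'.dvd_or_dvd (h2 ▸ hpτ.mul_right w)).resolve_left hN
  have hσp : (p : ℤ) ∣ σ := by
    rw [← ZMod.intCast_zmod_eq_zero_iff_dvd] at hsq hu ⊢
    rw [← hsq, hσ]
    push_cast
    refine Finset.sum_congr rfl fun i _ => ?_
    rw [hEf, centred, evenFun_cast_zmod hu]
    push_cast
    rfl
  simp only [← ZMod.intCast_zmod_eq_zero_iff_dvd] at hu hv hpk hσp hpτ hfin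
  have hSp : (S : ZMod p) = h := oddSeq_cast_zmod hu h
  have hgp : (g : ZMod p) = 2 := by
    simp [hg, hG, hσp, hpk]
  have hrp : (r : ZMod p) = 2 := by
    rw [hr]; push_cast; rw [hpk, hσp]; ring
  push_cast at hfin hv
  -- Here τ = 0, S = h and g = r = 2, so 2s² = 4h = -2.
  have hsp : ((s : ℤ) : ZMod p) ^ 2 = -1 := by
    have : 2 * ((s : ℤ) : ZMod p) ^ 2 = 2 * -1 := by
      rw [hpτ, hgp, hrp, hSp] at hfin
      linear_combination hfin + 2 * hv
    have two : (2 : ZMod p) ≠ 0 := by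
      intro h2
      have h2' : ((2 : ℕ) : ZMod p) = 0 := by exact_mod_cast h2
      rw [ZMod.natCast_eq_zero_iff] at h2'
      exact hp2 ((Nat.prime_dvd_prime_iff_eq hp Nat.prime_two).1 h2')
    exact mul_left_cancel₀ two this
  exact ZMod.mod_four_ne_three_of_sq_eq_neg_one hsp hp4

/-! ### Nonsingularity: the Gram form is positive definite for u > 4. -/

theorem sum_mul_gram (u lam : ℤ) {h : ℕ} (x : Fin (2 * h + 1) → ℤ) :
    ∑ i, x i * gram u lam x i =
      (u - 4) * ∑ i, x i ^ 2 + ∑ i, (x i + x (i + 1)) ^ 2 + lam * (∑ i, x i) ^ 2 := by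
  have h1 := Equiv.sum_comp (Equiv.addRight (1 : Fin (2 * h + 1))) fun i => x i ^ 2
  have h2 := Equiv.sum_comp (Equiv.addRight (1 : Fin (2 * h + 1))) fun i => x i * x (i - 1)
  simp only [Equiv.coe_addRight, add_sub_cancel_right] at h1 h2
  have e1 (i : Fin (2 * h + 1)) : x i * gram u lam x i = (u - 2) * x i ^ 2 +
      x (i + 1) * x i + x i * x (i - 1) + (lam * ∑ j, x j) * x i := by
    simp only [gram, cycDiff]; ring
  have e2 (i : Fin (2 * h + 1)) : (x i + x (i + 1)) ^ 2 =
      x i ^ 2 + x (i + 1) ^ 2 + 2 * (x (i + 1) * x i) := by ring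
  simp only [e1, e2, Finset.sum_add_distrib, ← Finset.mul_sum, h1, ← h2]
  ring

theorem det_ne_zero_of_mul_transpose_eq_gram {h : ℕ} {lam u : ℤ} (hu : 4 < u) (hlam : 0 ≤ lam)
    (A : Matrix (Fin (2 * h + 1)) (Fin (2 * h + 1)) ℤ)
    (hA : ∀ x, A *ᵥ (Aᵀ *ᵥ x) = gram u lam x) : A.det ≠ 0 := by
  intro hdet
  obtain ⟨x, hx0, hx⟩ := exists_vecMul_eq_zero_iff.2 hdet
  have hg : gram u lam x = 0 := by rw [← hA, mulVec_transpose, hx, mulVec_zero]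
  have hsum := sum_mul_gram u lam x
  simp only [hg, Pi.zero_apply, mul_zero, Finset.sum_const_zero] at hsum
  obtain ⟨i, hi⟩ := Function.ne_iff.1 hx0
  have h1 : 0 < ∑ i, x i ^ 2 :=
    Finset.sum_pos' (fun i _ => sq_nonneg _) ⟨i, Finset.mem_univ _, sq_pos_of_ne_zero hi⟩
  have h2 : 0 ≤ ∑ i, (x i + x (i + 1)) ^ 2 := Finset.sum_nonneg fun i _ => sq_nonneg _
  have h3 : 0 ≤ lam * (∑ i, x i) ^ 2 := by positivity
  have h4 : 0 < (u - 4) * ∑ i, x i ^ 2 := mul_pos (by linarith) h1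
  linarith

/-! ### The incidence matrix of the covering. -/

theorem exists_eq_map_univ {α : Type*} {n : ℕ} (s : Multiset α) (hs : Multiset.card s = n) :
    ∃ B : Fin n → α, s = Finset.univ.val.map B := by
  subst hs
  induction s using Quotient.inductionOn with
  | h l =>
    refine ⟨l.get, ?_⟩
    have := Fin.univ_val_map l.get
    rw [List.ofFn_get] at this
    exact this.symm

theorem exists_equiv_mult {V : Type*} [Fintype V] [DecidableEq V] {G : LooplessMultigraph V}
    (hG : G.IsHamiltonCycle) {h : ℕ} (hn : Fintype.card V = 2 * h + 1) :
    ∃ e : Fin (2 * h + 1) ≃ V, ∀ i j, i ≠ j → G.mult (e i) (e j) =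
      (if j = i + 1 then 1 else 0) + (if j = i - 1 then 1 else 0) := by
  obtain ⟨e, he⟩ : ∃ e : Fin (2 * h + 1) ≃ V, ∀ x y : V, G.mult x y =
      (Finset.univ.filter fun i : Fin (2 * h + 1) =>
        s(e i, e (finRotate (2 * h + 1) i)) = s(x, y)).card := hn ▸ hG.2
  refine ⟨e, fun i j hij => ?_⟩
  rw [he]
  have hiff (t : Fin (2 * h + 1)) : s(e t, e (finRotate (2 * h + 1) t)) = s(e i, e j) ↔
      (t = i ∧ j = i + 1) ∨ (t = j ∧ j = i - 1) := by
    rw [finRotate_apply, Sym2.eq_iff]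
    simp only [EmbeddingLike.apply_eq_iff_eq]
    constructor
    · rintro (⟨rfl, rfl⟩ | ⟨rfl, rfl⟩) <;> simp
    · rintro (⟨rfl, rfl⟩ | ⟨rfl, rfl⟩) <;> simp
  simp only [hiff, Finset.card_filter]
  have hadd (t : Fin (2 * h + 1)) :
      (if (t = i ∧ j = i + 1) ∨ (t = j ∧ j = i - 1) then 1 else 0) =
      (if t = i then (if j = i + 1 then 1 else 0) else 0) +
        (if t = j then (if j = i - 1 then 1 else 0) else 0) := by
    by_cases h1 : t = i
    · subst h1; simp [hij]
    · simp [h1, ite_and]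
  simp only [hadd, Finset.sum_add_distrib, Finset.sum_ite_eq', Finset.mem_univ, if_true]

/-- The incidence matrix of a symmetric covering with Hamiltonian excess. -/
theorem exists_incidence_matrix {V : Type*} [Fintype V] [DecidableEq V] {h k lam : ℕ}
    (hk : 1 < k) (hn : (lam : ℤ) * (2 * h) + 2 = k * (k - 1))
    (C : PairCovering V (2 * h + 1) k lam) (hC : C.IsSymmetric)
    (hE : C.excess.IsHamiltonCycle) :
    ∃ A : Matrix (Fin (2 * h + 1)) (Fin (2 * h + 1)) ℤ,
      (∀ b, ∑ i, A i b = k) ∧ ∀ x, A *ᵥ (Aᵀ *ᵥ x) = gram (k - lam + 2) lam x := by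
  obtain ⟨e, he⟩ := exists_equiv_mult hE C.card_points
  obtain ⟨B, hB⟩ := exists_eq_map_univ C.blocks hC
  have hh : h ≠ 0 := by
    rintro rfl
    have := hE.1
    have := C.card_points
    omega
  have hr (x y : V) : (C.r x y : ℤ) =
      ∑ b, (if x ∈ B b then 1 else 0) * (if y ∈ B b then 1 else 0) := by
    have : C.r x y = (Finset.univ.filter fun b => x ∈ B b ∧ y ∈ B b).card := by
      rw [PairCovering.r, hB, Multiset.filter_map, Multiset.card_map]
      rfl
    rw [this, Finset.card_filter]
    push_cast
    exact Finset.sum_congr rfl fun b _ => by rw [ite_and]; split_ifs <;> simp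
  set A : Matrix (Fin (2 * h + 1)) (Fin (2 * h + 1)) ℤ :=
    Matrix.of fun i b => if e i ∈ B b then 1 else 0 with hA
  have hcol (b) : ∑ i, A i b = k := by
    have : (B b).card = k := C.card_block _ (by rw [hB]; exact Multiset.mem_map_of_mem _ (by simp))
    rw [← this]
    simp only [hA, of_apply]
    rw [Equiv.sum_comp e fun x => if x ∈ B b then (1 : ℤ) else 0]
    simp
  have hAA (i j) : (A * Aᵀ) i j = C.r (e i) (e j) := by
    rw [hr, mul_apply]; rfl
  have hne (i j) (hij : i ≠ j) : (C.r (e i) (e j) : ℤ) =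
      lam + (if j = i + 1 then 1 else 0) + (if j = i - 1 then 1 else 0) := by
    have h1 := he i j hij
    have hij' : e i ≠ e j := e.injective.ne hij
    have h2 : lam ≤ C.r (e i) (e j) := C.covers _ _ hij'
    simp only [PairCovering.excess, if_neg hij'] at h1
    have h3 : C.r (e i) (e j) =
        lam + (if j = i + 1 then 1 else 0) + (if j = i - 1 then 1 else 0) := by omega
    rw [h3]
    push_cast
    rfl
  have h1 : (1 : Fin (2 * h + 1)) ≠ 0 := by
    obtain ⟨m, rfl⟩ := Nat.exists_eq_succ_of_ne_zero hh
    simp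
  have hentry (i j) : (C.r (e i) (e j) : ℤ) = (if j = i then (C.r (e i) (e i) : ℤ) - lam else 0) +
      lam + (if j = i + 1 then 1 else 0) + (if j = i - 1 then 1 else 0) := by
    by_cases hij : j = i
    · subst hij
      simp [h1, sub_eq_self, eq_comm (a := j) (b := j - 1)]
    · rw [hne i j (Ne.symm hij), if_neg hij]; ring
  have hmul (x : Fin (2 * h + 1) → ℤ) (i) : (A *ᵥ (Aᵀ *ᵥ x)) i =
      (C.r (e i) (e i) - lam) * x i + lam * ∑ j, x j + x (i + 1) + x (i - 1) := by
    rw [mulVec_mulVec, mulVec, dotProduct]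
    simp_rw [hAA]
    rw [Finset.sum_congr rfl fun j _ => congrArg (· * x j) (hentry i j)]
    simp only [add_mul, ite_mul, zero_mul, one_mul, Finset.sum_add_distrib,
      Finset.sum_ite_eq', Finset.mem_univ, if_true, Finset.mul_sum]
  -- Applying A Aᵀ to the all-one vector counts incidences: ρk = (ρ - λ) + λv + 2 for the
  -- replication number ρ, hence ρ(k - 1) = k(k - 1).
  have hdiag (i) : (C.r (e i) (e i) : ℤ) = k := by
    have h2 := hmul (fun _ => 1) i
    have h3 : Aᵀ *ᵥ (fun _ => 1) = fun _ => (k : ℤ) := by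
      ext b
      simp only [mulVec, dotProduct, transpose_apply, mul_one, hcol]
    have h4 : (C.r (e i) (e i) : ℤ) = ∑ b, A i b := by
      rw [hr]
      exact Finset.sum_congr rfl fun b _ => by simp only [hA, of_apply]; split_ifs <;> simp
    rw [h3, mulVec, dotProduct, ← Finset.sum_mul, ← h4] at h2
    simp only [Finset.sum_const, Finset.card_univ, Fintype.card_fin, nsmul_eq_mul] at h2
    push_cast at h2
    have hk' : (k : ℤ) - 1 ≠ 0 := by omega
    apply mul_right_cancel₀ hk'
    linear_combination h2 + hn
  refine ⟨A, hcol, fun x => funext fun i => ?_⟩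
  rw [hmul, hdiag, gram, cycDiff]
  ring

/-! ### Assembly, and the prime 3. -/

/-- There is no symmetric covering with Hamiltonian excess when a prime `p ≡ 3 [MOD 4]` divides
`v` and `k - lam + 2`, with `9 ∣ v` in the case `p = 3`. -/
theorem not_exists_covering {V : Type*} [Fintype V] [DecidableEq V] {h k lam p : ℕ}
    (hlk : lam + 2 < k) (hn : (lam : ℤ) * (2 * h) + 2 = k * (k - 1)) (hp : p.Prime)
    (hp4 : p % 4 = 3) (hv : p ∣ 2 * h + 1) (hu : (p : ℤ) ∣ k - lam + 2)
    (hp3 : p = 3 → 9 ∣ 2 * h + 1) (C : PairCovering V (2 * h + 1) k lam)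
    (hC : C.IsSymmetric) : ¬ C.excess.IsHamiltonCycle := by
  intro hE
  have : Fact p.Prime := ⟨hp⟩
  obtain ⟨A, hcol, hA⟩ := exists_incidence_matrix (by omega) hn C hC hE
  have hpr : Prime (p : ℤ) := Nat.prime_iff_prime_int.1 hp
  have key (m c : ℤ) (hm : 3 * m = (2 * h + 1) * c) : (p : ℤ) ∣ m := by
    by_cases h3 : p = 3
    · have h9 : (9 : ℤ) ∣ 2 * h + 1 := by exact_mod_cast hp3 h3
      obtain ⟨d, hd⟩ := h9
      refine ⟨d * c, ?_⟩
      rw [hd] at hm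
      subst h3
      push_cast
      linarith
    · have hv' : (p : ℤ) ∣ 2 * h + 1 := by exact_mod_cast hv
      refine (hpr.dvd_or_dvd (hm ▸ hv'.mul_right c : (p : ℤ) ∣ 3 * m)).resolve_left fun h => h3 ?_
      exact (Nat.prime_dvd_prime_iff_eq hp Nat.prime_three).1 (by exact_mod_cast h)
  refine false_of_mul_transpose_eq_gram hp4 (k := k) (u := k - lam + 2) (lam := lam)
    (by omega) (by omega) (by linarith) hu (by exact_mod_cast hv)
    (key _ _ ((three_mul_sum_sq h).trans (mul_assoc _ _ _)))
    (key _ (2 * h * (2 * h + 2)) ?_) A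
    (det_ne_zero_of_mul_transpose_eq_gram (by omega) (by omega) A hA) hA 0 (hcol 0)
  rw [three_mul_sum_mul_succ]
  push_cast
  ring

end HamiltonExcess

theorem mainTheorem2 (v k lam : ℕ) (hv : 0 < v) (hk : 0 < k) (hlam : 0 < lam)
    (hkl : lam + 2 < k)
    (hvkl : (v : ℚ) = ((k : ℚ) * ((k : ℚ) - 1) - 2) / (lam : ℚ) + 1)
    (hodd : Odd v)
    (hp : ∃ p : ℕ, p.Prime ∧ p ≡ 3 [MOD 4] ∧ p ∣ v ∧ p ∣ k - lam + 2 ∧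
      ((Odd (padicValNat p (k - lam + 2)) ∧
          (p, padicValNat p (k - lam + 2)) ≠ (3, 1) ∧
          ((2 < lam ∧ padicValNat p (k - lam + 2) < 2 * padicValNat p (lam - 2)) ∨ lam = 2)) ∨
        (2 < lam ∧ padicValNat p (k - lam + 2) = 2 * padicValNat p (lam - 2) ∧
          Odd (padicValNat p v))))
    (V : Type*) [Fintype V] [DecidableEq V] :
    ¬ ∃ C : PairCovering V v k lam, C.IsSymmetric ∧ C.excess.IsHamiltonCycle := by
  rintro ⟨C, hC, hE⟩
  obtain ⟨p, hp, hp4, hpv, hpu, hcase⟩ := hp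
  obtain ⟨h, rfl⟩ := hodd
  have hn : (lam : ℤ) * (2 * h) + 2 = k * (k - 1) := by
    have hl : (lam : ℚ) ≠ 0 := by positivity
    field_simp at hvkl
    push_cast at hvkl
    have : (lam : ℚ) * (2 * h) + 2 = k * (k - 1) := by linarith
    exact_mod_cast this
  have hcast : ((k - lam + 2 : ℕ) : ℤ) = k - lam + 2 := by omega
  refine HamiltonExcess.not_exists_covering hkl hn hp hp4 hpv
    (by rw [← hcast]; exact_mod_cast hpu) ?_ C hC hE
  rintro rfl
  have : Fact (Nat.Prime 3) := ⟨Nat.prime_three⟩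
  have hval : 1 ≤ padicValNat 3 (k - lam + 2) := one_le_padicValNat_of_dvd (by omega) hpu
  -- A positive exponent is at least 2 if it is not 1, as in (i), or if it is even, as in (ii).
  have hval2 : 2 ≤ padicValNat 3 (k - lam + 2) := by
    rcases hcase with ⟨_, h1, _⟩ | ⟨_, h1, _⟩
    · have : padicValNat 3 (k - lam + 2) ≠ 1 := fun h2 => h1 (by rw [h2])
      omega
    · omega
  have h9 : 9 ∣ k - lam + 2 := (pow_dvd_pow 3 hval2).trans pow_padicValNat_dvd
  have hk2 : (k : ℤ) ^ 2 = (k - lam + 2) + lam * (2 * h + 1) := by linarith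
  have h9u : (9 : ℤ) ∣ k - lam + 2 := by rw [← hcast]; exact_mod_cast h9
  have h3v : (3 : ℤ) ∣ 2 * h + 1 := by exact_mod_cast hpv
  have h3k : (3 : ℤ) ∣ k := Int.prime_three.dvd_of_dvd_pow
    (hk2 ▸ dvd_add ((by norm_num : (3 : ℤ) ∣ 9).trans h9u) (h3v.mul_left _))
  have h9v : (3 : ℤ) ^ 2 ∣ lam * (2 * h + 1) := by
    rw [show (lam : ℤ) * (2 * h + 1) = k ^ 2 - (k - lam + 2) by linarith]
    exact dvd_sub (pow_dvd_pow_of_dvd h3k 2) h9u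
  -- Since 3 divides k and k - λ + 2, λ ≡ 2 mod 3; so 9 ∣ λv passes to 9 ∣ v.
  have hcop : IsCoprime ((3 : ℤ) ^ 2) lam := by
    refine IsCoprime.pow_left ((Prime.coprime_iff_not_dvd Int.prime_three).2 fun h => ?_)
    omega
  have := hcop.dvd_of_dvd_mul_left h9v
  norm_num at this
  exact_mod_cast this
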